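/- Let $d\ge 1$, $L>0$, $\gamma=(\gamma_1,\dots,\gamma_d)$ with all $\gamma_j>0$, $\mathbf R_L^{\gamma}=\prod_{j=1}^d[-L\gamma_j,L\gamma_j]$ and $R_0=\min_j 2L\gamma_j$. Let $\rho:\mathbb R^d\to\mathbb R$ be a $C^\infty$ function supported in $\mathbf R_L^{\gamma}$. Let $U(\mathbf x)=U(|\mathbf x|)$ be a real, radially symmetric, locally integrable kernel on $\mathbb R^d$, and let $U^\varepsilon$ be a far-field smooth approximation (FSA) of $U$, that is, a real function on $\mathbb R^d$ such that (a) $U^\varepsilon$ is $C^\infty$ on $\mathbb R^d$ and radially symmetric; (b) $\int_{R_0}^\infty |(U-U^\varepsilon)(r)|\,r^{d-1}\,dr\le\varepsilon_{\rm tol}$ (the integral being convergent). Let $\Phi(\mathbf x)=\int_{\mathbb R^d}U(\mathbf x-\mathbf y)\rho(\mathbf y)\,d\mathbf y$. For even $N\ge 2$ put $h_j=2L\gamma_j/N$, $\mathbf x_{\mathbf n}=(n_1h_1,\dots,n_dh_d)$ for $\mathbf n\in\mathcal I_N=\{-N/2,\dots,N/2-1\}^d$, and $\mathbf k_{\mathbf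 p}=\big(\tfrac{\pi p_1}{2L\gamma_1},\dots,\tfrac{\pi p_d}{2L\gamma_d}\big)$ for $\mathbf p\in\mathcal I_{2N}=\{-N,\dots,N-1\}^d$. With $\widehat{(U-U^\varepsilon)}(\mathbf k)=\int_{\mathbb R^d}(U-U^\varepsilon)(\mathbf y)e^{-i\mathbf k\cdot\mathbf y}\,d\mathbf y$, let $$T(\mathbf z)=h_1\cdots h_d\,U^\varepsilon(\mathbf z)+\frac1{(2N)^d}\sum_{\mathbf p\in\mathcal I_{2N}}\widehat{(U-U^\varepsilon)}(\mathbf k_{\mathbf p})\,e^{i\mathbf k_{\mathbf p}\cdot\mathbf z},\qquad \Phi_N(\mathbf x)=\sum_{\mathbf n\in\mathcal I_N}T(\mathbf x-\mathbf x_{\mathbf n})\,\rho(\mathbf x_{\mathbf n}).$$ Then the integrals defining $\Phi$ and $\widehat{(U-U^\varepsilon)}$ converge absolutely, and for every positive integer $m$ $$\|\Phi-\Phi_N\|_{L^\infty(\mathbf R_L^{\gamma})}\lesssim N^{-m}+\varepsilon_{\rm tol}.$$ More precisely, there is a constant $C_1$ depending only on $d,L,\gamma,\rho$, and for every $m$ a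 constant $C_2$ independent of $N$ (it may depend on all the other data, including $U$, $U^\varepsilon$ and $m$), such that for all even $N\ge2$ one has $|\Phi(\mathbf x)-\Phi_N(\mathbf x)|\le C_2N^{-m}+C_1\varepsilon_{\rm tol}$ at every $\mathbf x\in\mathbf R_L^{\gamma}$; in particular $\|\Phi-\Phi_N\|_{L^\infty(\mathbf R_L^{\gamma})}\le C_2N^{-m}+C_1\varepsilon_{\rm tol}$. -/

import Mathlib

open scoped ContDiff

noncomputable section

namespace FSA

/-- The closed box `∏ j, [-L γ_j, L γ_j]` in `ℝ^d`. -/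
def box {d : ℕ} (L : ℝ) (γ : Fin d → ℝ) : Set (EuclideanSpace ℝ (Fin d)) :=
  {x | ∀ j, x j ∈ Set.Icc (-(L * γ j)) (L * γ j)}

/-- `R₀ = min_j 2 L γ_j`. -/
def innerRadius {d : ℕ} (L : ℝ) (γ : Fin d → ℝ) : ℝ :=
  ⨅ j, 2 * L * γ j

/-- The radial profile `v` is a far-field smooth approximation of the radial profile `u` in `ℝ^d`
beyond the radius `R₀`, with resolution `εtol`: the radially symmetric function `x ↦ v ‖x‖` is
smooth on the whole of `ℝ^d`, and `∫_{R₀}^∞ |u - v|(r) r^(d-1) dr` converges and is at most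
`εtol`. -/
structure IsFarFieldApprox (d : ℕ) (R₀ εtol : ℝ) (u v : ℝ → ℝ) : Prop where
  smooth : ContDiff ℝ ∞ (fun x : EuclideanSpace ℝ (Fin d) => v ‖x‖)
  tail_integrable :
    MeasureTheory.IntegrableOn (fun r : ℝ => |u r - v r| * r ^ (d - 1)) (Set.Ioi R₀)
  tail_le : ∫ r in Set.Ioi R₀, |u r - v r| * r ^ (d - 1) ≤ εtol

/-- The convolution potential `Φ(x) = ∫ U(x - y) ρ(y) dy` with `U(x) = u ‖x‖`. -/
def potential {d : ℕ} (u : ℝ → ℝ) (ρ : EuclideanSpace ℝ (Fin d) → ℝ)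
    (x : EuclideanSpace ℝ (Fin d)) : ℝ :=
  ∫ y, u ‖x - y‖ * ρ y

/-- The whole-space Fourier transform `∫ (U - V)(y) exp(-i k·y) dy` of the residual kernel. -/
def residualFourier {d : ℕ} (u v : ℝ → ℝ) (k : EuclideanSpace ℝ (Fin d)) : ℂ :=
  ∫ y : EuclideanSpace ℝ (Fin d),
    ((u ‖y‖ - v ‖y‖ : ℝ) : ℂ) * Complex.exp (-(Complex.I * ((∑ j, k j * y j : ℝ) : ℂ)))

/-- The index set `{-M, …, M - 1}^d`. -/
def indexSet (d M : ℕ) : Finset (Fin d → ℤ) :=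
  Fintype.piFinset fun _ => Finset.Ico (-(M : ℤ)) (M : ℤ)

/-- The mesh size `h_j = 2 L γ_j / N` in the `j`-th direction. -/
def meshSize {d : ℕ} (L : ℝ) (γ : Fin d → ℝ) (N : ℕ) (j : Fin d) : ℝ :=
  2 * L * γ j / N

/-- The grid point `(n_1 h_1, …, n_d h_d)`. -/
def gridPoint {d : ℕ} (L : ℝ) (γ : Fin d → ℝ) (N : ℕ) (n : Fin d → ℤ) :
    EuclideanSpace ℝ (Fin d) :=
  WithLp.toLp 2 fun j => (n j : ℝ) * meshSize L γ N j

/-- The Fourier mode `(π p_1 / (2 L γ_1), …, π p_d / (2 L γ_d))` of the doubled box. -/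
def fourierMode {d : ℕ} (L : ℝ) (γ : Fin d → ℝ) (p : Fin d → ℤ) :
    EuclideanSpace ℝ (Fin d) :=
  WithLp.toLp 2 fun j => Real.pi * (p j : ℝ) / (2 * L * γ j)

/-- The convolution tensor as a function of the displacement `z`:
`h_1 ⋯ h_d V(z) + (2N)^(-d) ∑_p (U - V)^(k_p) exp(i k_p·z)`, the sum being over
`p ∈ {-N, …, N - 1}^d`.  At `z = (n_1 h_1, …, n_d h_d)` one has
`k_p·z = (2π / (2N)) ∑ j, p_j n_j`, and this is the entry `T_n` of the discrete tensor. -/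
def tensor {d : ℕ} (L : ℝ) (γ : Fin d → ℝ) (u v : ℝ → ℝ) (N : ℕ)
    (z : EuclideanSpace ℝ (Fin d)) : ℂ :=
  (((∏ j, meshSize L γ N j) * v ‖z‖ : ℝ) : ℂ) +
    1 / (2 * (N : ℂ)) ^ d * ∑ p ∈ indexSet d N,
      residualFourier u v (fourierMode L γ p) *
        Complex.exp (Complex.I * ((∑ j, fourierMode L γ p j * z j : ℝ) : ℂ))

/-- The discrete convolution `Φ_N(x) = ∑_n T(x - x_n) ρ(x_n)`, the sum being over
`n ∈ {-N/2, …, N/2 - 1}^d`  (`N` even), as a function of `x ∈ ℝ^d`. -/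
def approxPotential {d : ℕ} (L : ℝ) (γ : Fin d → ℝ) (u v : ℝ → ℝ)
    (ρ : EuclideanSpace ℝ (Fin d) → ℝ) (N : ℕ) (x : EuclideanSpace ℝ (Fin d)) : ℂ :=
  ∑ n ∈ indexSet d (N / 2),
    tensor L γ u v N (x - gridPoint L γ N n) * ((ρ (gridPoint L γ N n) : ℝ) : ℂ)

end FSA

end

namespace FSA

open MeasureTheory Filter Topology

/-! Write `U = V + W` with `V = U^ε` smooth and `W = U - V`; the two halves of the tensor treat them
separately.

For `V`, the discrete sum is the rectangle rule for `y ↦ V(x - y) ρ(y)`, smooth and supported in the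
box. Its error is a sum of Fourier coefficients at the nonzero frequencies aliased to `0`, hence
below every power of `1/N`, uniformly for `x` in the compact box (`norm_quadrature_sub_le`,
`exists_coeff_decay`).

For `W`, which is integrable, the Fourier sum is exactly `W` convolved with the trigonometric
interpolant of `ρ` on the doubled box, of period `4Lγ_j` (`sum_fourier_part_eq_integral`). What
remains is `∫ W(y) (ρ - interpolant)(x - y) dy`. If `|y| ≤ R₀` and `x` is in the box, then `|x_j -
y_j| ≤ 3Lγ_j`; the periodic images of `ρ` begin only there, so `ρ` equals its Fourier series and
only the spectrally small interpolation error is left (`hasSum_of_mem_enlarged_cube`,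
`norm_interpolate_sub_le`). If `|y| > R₀`, images may be seen, but they are bounded by the `ℓ¹` norm
of the coefficients of `ρ`, and `W` has mass at most a multiple of `εtol` there. That bound involves
only `ρ` and the box, whence `C₁`. -/

/-- The exponential monomial `t ↦ exp (2 π i r·t)` on `ℝ^d`. -/
noncomputable def mExp {d : ℕ} (r : Fin d → ℤ) (t : Fin d → ℝ) : ℂ :=
  Complex.exp (2 * Real.pi * Complex.I * ((∑ j, (r j : ℝ) * t j : ℝ) : ℂ))

/-! ### Fourier series on the centred unit cube -/

section Exponentials

variable {d : ℕ}

theorem mExp_add_right (r : Fin d → ℤ) (s t : Fin d → ℝ) :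
    mExp r (s + t) = mExp r s * mExp r t := by
  simp only [mExp, ← Complex.exp_add, Pi.add_apply, mul_add, Finset.sum_add_distrib]
  push_cast
  ring_nf

theorem mExp_add_left (r q : Fin d → ℤ) (t : Fin d → ℝ) :
    mExp (r + q) t = mExp r t * mExp q t := by
  simp only [mExp, ← Complex.exp_add, Pi.add_apply, Int.cast_add, add_mul, Finset.sum_add_distrib]
  push_cast
  ring_nf

theorem mExp_neg_right (r : Fin d → ℤ) (t : Fin d → ℝ) : mExp r (-t) = mExp (-r) t := by
  simp [mExp]

theorem mExp_zero (t : Fin d → ℝ) : mExp 0 t = 1 := by simp [mExp]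

theorem norm_mExp (r : Fin d → ℤ) (t : Fin d → ℝ) : ‖mExp r t‖ = 1 := by
  rw [mExp, Complex.norm_exp]
  simp

theorem continuous_mExp (r : Fin d → ℤ) : Continuous (mExp r) := by
  unfold mExp
  fun_prop

theorem mExp_eq_prod (r : Fin d → ℤ) (t : Fin d → ℝ) :
    mExp r t = ∏ j, Complex.exp (2 * Real.pi * Complex.I * (r j * t j)) := by
  rw [mExp, ← Complex.exp_sum]
  push_cast
  rw [Finset.mul_sum]

theorem mFourier_coe (r : Fin d → ℤ) (t : Fin d → ℝ) :
    UnitAddTorus.mFourier r (fun j => (t j : UnitAddCircle)) = mExp r t := by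
  rw [mExp_eq_prod]
  simp only [UnitAddTorus.mFourier, ContinuousMap.coe_mk, fourier_coe_apply]
  refine Finset.prod_congr rfl fun j _ => ?_
  congr 1
  push_cast
  ring

/-- The `r`-th Fourier coefficient of a function on `ℝ^d`, regarded as living on the unit cube. -/
noncomputable def coeff (φ : (Fin d → ℝ) → ℂ) (r : Fin d → ℤ) : ℂ :=
  ∫ t, mExp (-r) t * φ t

/-- The representative in `(-1/2, 1/2]` jumps at the faces, but its absolute value is the torus norm
and so stays continuous. -/
theorem abs_equivIoc_eq_norm (y : UnitAddCircle) :
    |(AddCircle.equivIoc 1 (-(1 / 2 : ℝ)) y : ℝ)| = ‖y‖ := by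
  have h := (AddCircle.equivIoc 1 (-(1 / 2 : ℝ)) y).2
  have hy : (((AddCircle.equivIoc 1 (-(1 / 2 : ℝ)) y : ℝ)) : UnitAddCircle) = y :=
    AddCircle.coe_equivIoc
  conv_rhs => rw [← hy]
  refine ((AddCircle.norm_coe_eq_abs_iff 1 one_ne_zero).2 ?_).symm
  rw [abs_le, abs_one]
  constructor <;> linarith [h.1, h.2]

/-- The periodization of a function supported in the centred unit cube is continuous. -/
theorem continuous_periodization {φ : (Fin d → ℝ) → ℂ} (hφ : Continuous φ)
    (h0 : ∀ t, (∃ j, 1 / 2 ≤ |t j|) → φ t = 0) :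
    Continuous (fun x : UnitAddTorus (Fin d) =>
      φ fun j => (AddCircle.equivIoc 1 (-(1 / 2 : ℝ)) (x j) : ℝ)) := by
  have hsupp : HasCompactSupport φ := by
    refine HasCompactSupport.of_support_subset_isCompact
      (isCompact_closedBall (0 : Fin d → ℝ) (1 / 2)) fun t ht => ?_
    rw [mem_closedBall_zero_iff, pi_norm_le_iff_of_nonneg (by norm_num)]
    intro j
    by_contra! hj
    exact ht (h0 t ⟨j, hj.le⟩)
  have huc := hsupp.uniformContinuous_of_continuous hφ
  rw [continuous_iff_continuousAt]
  intro x
  -- Only at the faces can the representative jump. Nearby representatives may then lie close to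
  -- either face, so uniform continuity is needed instead of continuity at one point.
  by_cases hx : ∃ j, ‖x j‖ = 1 / 2
  · obtain ⟨j, hj⟩ := hx
    have hzero : φ (fun j => (AddCircle.equivIoc 1 (-(1 / 2 : ℝ)) (x j) : ℝ)) = 0 :=
      h0 _ ⟨j, by rw [abs_equivIoc_eq_norm, hj]⟩
    rw [ContinuousAt, hzero, Metric.tendsto_nhds]
    intro ε hε
    obtain ⟨δ, hδ, H⟩ := Metric.uniformContinuous_iff.1 huc ε hε
    have hcont : Continuous fun y : UnitAddTorus (Fin d) => ‖y j‖ := by fun_prop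
    have hev := hcont.continuousAt.eventually (Metric.ball_mem_nhds (‖x j‖) hδ)
    filter_upwards [hev] with y hy
    rw [hj, Real.dist_eq, ← abs_equivIoc_eq_norm] at hy
    set s : Fin d → ℝ := fun j => (AddCircle.equivIoc 1 (-(1 / 2 : ℝ)) (y j) : ℝ) with hs
    have hle : |s j| ≤ 1 / 2 := by
      have h := (AddCircle.equivIoc 1 (-(1 / 2 : ℝ)) (y j)).2
      rw [abs_le]
      constructor <;> linarith [h.1, h.2]
    obtain ⟨b, hb, hsb⟩ : ∃ b : ℝ, |b| = 1 / 2 ∧ |s j - b| < δ := by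
      change |(|s j| - 1 / 2)| < δ at hy
      rcases le_total 0 (s j) with hp | hp
      · exact ⟨1 / 2, by norm_num, by rwa [abs_of_nonneg hp] at hy⟩
      · refine ⟨-(1 / 2), by norm_num, ?_⟩
        rw [abs_of_nonpos hp, abs_sub_comm] at hy
        convert hy using 2
        ring
    have hb0 : φ (Function.update s j b) = 0 := h0 _ ⟨j, by simp [hb]⟩
    rw [← hb0]
    refine H ?_
    rw [dist_pi_lt_iff hδ]
    intro i
    by_cases hi : i = j
    · subst hi
      simpa [Real.dist_eq] using hsb
    · simpa [Function.update_of_ne hi] using hδ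
  · push Not at hx
    refine ContinuousAt.comp (g := φ) hφ.continuousAt ?_
    rw [continuousAt_pi]
    intro j
    have hne : x j ≠ ((-(1 / 2 : ℝ) : ℝ) : UnitAddCircle) := by
      intro h
      apply hx j
      rw [h, (AddCircle.norm_coe_eq_abs_iff 1 one_ne_zero).2] <;> norm_num
    have h1 := AddCircle.continuousAt_equivIoc 1 (-(1 / 2 : ℝ)) hne
    exact ContinuousAt.comp (f := fun y : UnitAddTorus (Fin d) => y j)
      (continuous_subtype_val.continuousAt.comp h1) (continuous_apply j).continuousAt

/-- Pointwise Fourier inversion on the centred unit cube. -/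
theorem hasSum_coeff_mul_mExp {φ : (Fin d → ℝ) → ℂ} (hφ : Continuous φ)
    (h0 : ∀ t, (∃ j, 1 / 2 ≤ |t j|) → φ t = 0) (hs : Summable (coeff φ))
    {t : Fin d → ℝ} (ht : ∀ j, |t j| ≤ 1 / 2) :
    HasSum (fun r => coeff φ r * mExp r t) (φ t) := by
  set F : C(UnitAddTorus (Fin d), ℂ) := ⟨_, continuous_periodization hφ h0⟩ with hF
  have hcube : ∀ s : Fin d → ℝ, (∀ j, s j ∈ Set.Ioc (-(1 / 2 : ℝ)) (-(1 / 2) + 1)) →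
      F (fun j => (s j : UnitAddCircle)) = φ s := by
    intro s hs
    change φ _ = φ s
    congr 1
    funext j
    exact AddCircle.equivIoc_coe_of_mem (hs j)
  have hmeas : MeasurableSet {x : Fin d → ℝ | ∀ i, x i ∈ Set.Ioc (-(1 / 2 : ℝ)) (-(1 / 2) + 1)} :=
    MeasurableSet.univ_pi' fun i => measurableSet_Ioc
  have hcoef : ∀ r, UnitAddTorus.mFourierCoeff F r = coeff φ r := by
    intro r
    rw [UnitAddTorus.mFourierCoeff_eq_integral F r (fun _ => -(1 / 2 : ℝ))]
    refine (setIntegral_congr_fun (g := fun s => mExp (-r) s * φ s) hmeas fun s hs => ?_).trans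
      (setIntegral_eq_integral_of_forall_compl_eq_zero ?_)
    · simp only [mFourier_coe, smul_eq_mul, hcube s hs]
    · intro s hs
      simp only [Set.mem_ofPred_eq, not_forall] at hs
      obtain ⟨j, hj⟩ := hs
      rw [h0 s ⟨j, ?_⟩, mul_zero]
      by_contra! h
      rw [abs_lt] at h
      exact hj ⟨by linarith [h.1], by linarith [h.2]⟩
  have hsum := UnitAddTorus.hasSum_mFourier_series_apply_of_summable (f := F)
    (by simpa only [funext hcoef] using hs) (fun j => (t j : UnitAddCircle))
  simp only [hcoef, mFourier_coe, smul_eq_mul] at hsum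
  convert hsum using 1
  -- The half-open cube represents `-1/2` by `1/2`; on the faces both values of `φ` vanish.
  by_cases hb : ∃ j, |t j| = 1 / 2
  · obtain ⟨j, hj⟩ := hb
    rw [h0 t ⟨j, hj.ge⟩]
    refine (h0 _ ⟨j, ?_⟩).symm
    rw [abs_equivIoc_eq_norm, (AddCircle.norm_coe_eq_abs_iff 1 one_ne_zero).2, hj]
    rw [hj]; norm_num
  · push Not at hb
    refine (hcube t fun j => ?_).symm
    have := abs_lt.1 (lt_of_le_of_ne (ht j) (hb j))
    exact ⟨by linarith [this.1], by linarith [this.2]⟩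

end Exponentials

/-! ### Aliasing, quadrature and interpolation on the grid -/

section DiscreteFourier

variable {d : ℕ}

/-- A geometric sum whose ratio `ζ` satisfies `ζ ^ (2M) = 1`: it vanishes unless `ζ = 1`. -/
theorem sum_Ico_exp (M : ℕ) (hM : 0 < M) (k : ℤ) :
    ∑ n ∈ Finset.Ico (-(M : ℤ)) M,
        Complex.exp (2 * Real.pi * Complex.I * ((k : ℂ) * ((n : ℝ) / (2 * M) : ℝ))) =
      if (2 * M : ℤ) ∣ k then (2 * M : ℂ) else 0 := by
  have hM' : (M : ℂ) ≠ 0 := by exact_mod_cast hM.ne'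
  set ζ : ℂ := Complex.exp (2 * Real.pi * Complex.I * k / (2 * M)) with hζ
  have hterm : ∀ n : ℤ, Complex.exp (2 * Real.pi * Complex.I *
      ((k : ℂ) * ((n : ℝ) / (2 * M) : ℝ))) = ζ ^ n := by
    intro n
    rw [hζ, ← Complex.exp_int_mul]
    congr 1
    push_cast
    ring
  have hone : ζ = 1 ↔ (2 * M : ℤ) ∣ k := by
    rw [hζ, Complex.exp_eq_one_iff]
    constructor
    · rintro ⟨n, hn⟩
      refine ⟨n, ?_⟩
      have hpi : (2 * Real.pi * Complex.I : ℂ) ≠ 0 := Complex.two_pi_I_ne_zero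
      rw [div_eq_iff (by simpa using hM')] at hn
      have : (k : ℂ) = 2 * M * n := by
        apply mul_left_cancel₀ hpi
        rw [hn]; ring
      exact_mod_cast this
    · rintro ⟨n, rfl⟩
      refine ⟨n, ?_⟩
      push_cast
      field_simp
  have hpow : ζ ^ (2 * M) = 1 := by
    rw [hζ, ← Complex.exp_nat_mul, Complex.exp_eq_one_iff]
    refine ⟨k, ?_⟩
    push_cast
    field_simp
  have hζ0 : ζ ≠ 0 := Complex.exp_ne_zero _
  have hsum : ∑ n ∈ Finset.Ico (-(M : ℤ)) M, ζ ^ n =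
      ∑ i ∈ Finset.range (2 * M), ζ ^ (-(M : ℤ)) * ζ ^ i := by
    symm
    refine Finset.sum_bij (fun i _ => (i : ℤ) - M) ?_ ?_ ?_ ?_
    · intro i hi
      simp only [Finset.mem_range, Finset.mem_Ico] at hi ⊢
      omega
    · intro i _ j _ h
      simpa using h
    · intro n hn
      simp only [Finset.mem_Ico] at hn
      exact ⟨(n + M).toNat, by simp only [Finset.mem_range]; omega, by omega⟩
    · intro i _
      rw [sub_eq_neg_add, zpow_add₀ hζ0, zpow_natCast]
  rw [Finset.sum_congr rfl fun n _ => hterm n, hsum, ← Finset.mul_sum]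
  split_ifs with h
  · rw [hone.2 h]
    simp
  · have hne : ζ ≠ 1 := fun h' => h (hone.1 h')
    rw [geom_sum_eq hne, hpow]
    simp

/-- The point `n / (2 M)` of the equispaced grid in the centred unit cube. -/
noncomputable def unitGrid (M : ℕ) (n : Fin d → ℤ) : Fin d → ℝ := fun j => (n j : ℝ) / (2 * M)

theorem sum_mExp_unitGrid (M : ℕ) (hM : 0 < M) (k : Fin d → ℤ) :
    ∑ n ∈ indexSet d M, mExp k (unitGrid M n) =
      if ∀ j, (2 * M : ℤ) ∣ k j then (2 * M : ℂ) ^ d else 0 := by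
  simp only [mExp_eq_prod, indexSet, unitGrid]
  rw [← Finset.prod_univ_sum (fun _ => Finset.Ico (-(M : ℤ)) M)
    (fun j n => Complex.exp (2 * Real.pi * Complex.I * ((k j : ℂ) * ((n : ℝ) / (2 * M) : ℝ))))]
  simp only [sum_Ico_exp M hM]
  split_ifs with h
  · simp [h]
  · push Not at h
    obtain ⟨j, hj⟩ := h
    exact Finset.prod_eq_zero (Finset.mem_univ j) (by simp [hj])

theorem mem_indexSet {M : ℕ} {n : Fin d → ℤ} :
    n ∈ indexSet d M ↔ ∀ j, -(M : ℤ) ≤ n j ∧ n j < M := by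
  simp [indexSet]

/-- Every frequency has a unique alias in `{-M, …, M - 1}^d`. -/
theorem exists_alias (M : ℕ) (hM : 0 < M) (r : Fin d → ℤ) :
    ∃ s ∈ indexSet d M, (r ∈ indexSet d M → s = r) ∧
      ∀ p ∈ indexSet d M, ((∀ j, (2 * M : ℤ) ∣ (r - p) j) ↔ p = s) := by
  -- The alias is the residue modulo `2M`, shifted to lie in `[-M, M)`.
  have key : ∀ p ∈ indexSet d M, ((∀ j, (2 * M : ℤ) ∣ (r - p) j) ↔
      p = fun j => (r j + M) % (2 * M) - M) := by
    intro p hp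
    rw [mem_indexSet] at hp
    rw [funext_iff]
    refine forall_congr' fun j => ?_
    have h1 : (p j + M) % (2 * M) = p j + M :=
      Int.emod_eq_of_lt (by linarith [(hp j).1]) (by linarith [(hp j).2])
    rw [eq_sub_iff_add_eq, ← h1, Pi.sub_apply]
    constructor
    · intro h
      refine Int.emod_emod_of_dvd _ dvd_rfl ▸ ?_
      rw [Int.emod_emod_of_dvd _ dvd_rfl, eq_comm, Int.emod_eq_emod_iff_emod_sub_eq_zero]
      exact Int.emod_eq_zero_of_dvd (by simpa using h)
    · intro h
      have := Int.dvd_of_emod_eq_zero (Int.emod_eq_emod_iff_emod_sub_eq_zero.1 h.symm)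
      simpa using this
  refine ⟨_, ?_, fun hr => ((key r hr).1 (by simp)).symm, key⟩
  rw [mem_indexSet]
  intro j
  have h2 : (0 : ℤ) < 2 * M := by positivity
  have := Int.emod_nonneg (r j + M) h2.ne'
  have := Int.emod_lt_of_pos (r j + M) h2
  constructor <;> linarith

/-- Trigonometric interpolation on the grid replaces a monomial by its alias. -/
theorem interpolate_mExp (M : ℕ) (hM : 0 < M) (r : Fin d → ℤ) :
    ∃ s ∈ indexSet d M, (r ∈ indexSet d M → s = r) ∧ ∀ z : Fin d → ℝ,
      1 / (2 * (M : ℂ)) ^ d * ∑ n ∈ indexSet d M, ∑ p ∈ indexSet d M,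
        mExp p (z - unitGrid M n) * mExp r (unitGrid M n) = mExp s z := by
  obtain ⟨s, hs, hrs, hal⟩ := exists_alias M hM r
  refine ⟨s, hs, hrs, fun z => ?_⟩
  have hM' : (2 * (M : ℂ)) ^ d ≠ 0 := by
    have : (M : ℂ) ≠ 0 := by exact_mod_cast hM.ne'
    exact pow_ne_zero _ (by simpa)
  have hterm : ∀ p n, mExp p (z - unitGrid M n) * mExp r (unitGrid M n) =
      mExp p z * mExp (r - p) (unitGrid M n) := by
    intro p n
    rw [sub_eq_add_neg, mExp_add_right, mExp_neg_right, sub_eq_neg_add, mExp_add_left, mul_assoc]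
  -- With the sum over `n` innermost, orthogonality kills every `p` except the alias of `r`.
  rw [Finset.sum_comm]
  simp only [hterm, ← Finset.mul_sum, sum_mExp_unitGrid M hM]
  rw [Finset.sum_eq_single s]
  · rw [if_pos ((hal s hs).2 rfl)]
    field_simp
  · intro p hp hne
    rw [if_neg fun h => hne ((hal p hp).1 h), mul_zero]
  · exact fun h => absurd hs h

/-- The part of the `ℓ¹` norm of a sequence carried by frequencies outside `{-M, …, M - 1}^d`. -/
noncomputable def tail (c : (Fin d → ℤ) → ℂ) (M : ℕ) : ℝ :=
  ∑' r, ‖(indexSet d M : Set (Fin d → ℤ))ᶜ.indicator c r‖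

theorem summable_norm_indicator {c : (Fin d → ℤ) → ℂ} (hc : Summable fun r => ‖c r‖)
    (s : Set (Fin d → ℤ)) : Summable fun r => ‖s.indicator c r‖ :=
  Summable.of_nonneg_of_le (fun _ => norm_nonneg _) (fun _ => norm_indicator_le_norm_self _ _) hc

/-- The rectangle rule on the grid, for an absolutely convergent Fourier series. -/
theorem norm_quadrature_sub_le (M : ℕ) (hM : 0 < M) {c : (Fin d → ℤ) → ℂ}
    (hc : Summable fun r => ‖c r‖) {f : (Fin d → ℝ) → ℂ}
    (hf : ∀ n ∈ indexSet d M, HasSum (fun r => c r * mExp r (unitGrid M n)) (f (unitGrid M n))) :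
    ‖1 / (2 * (M : ℂ)) ^ d * ∑ n ∈ indexSet d M, f (unitGrid M n) - c 0‖ ≤ tail c M := by
  have hM' : (2 * (M : ℂ)) ^ d ≠ 0 := by
    have : (M : ℂ) ≠ 0 := by exact_mod_cast hM.ne'
    exact pow_ne_zero _ (by simpa)
  have h1 : HasSum (fun r => 1 / (2 * (M : ℂ)) ^ d *
      ∑ n ∈ indexSet d M, c r * mExp r (unitGrid M n))
      (1 / (2 * (M : ℂ)) ^ d * ∑ n ∈ indexSet d M, f (unitGrid M n)) :=
    (hasSum_sum hf).mul_left _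
  have h2 : HasSum (fun r : Fin d → ℤ => if r = 0 then c 0 else 0) (c 0) := hasSum_ite_eq 0 (c 0)
  have h3 := h1.sub h2
  rw [← h3.tsum_eq]
  refine tsum_of_norm_bounded (summable_norm_indicator hc _).hasSum fun r => ?_
  rw [← Finset.mul_sum, sum_mExp_unitGrid M hM]
  -- A resolved frequency is aliased to `0` only if it is `0`, and that term cancels; an unresolved
  -- one contributes `c r` or nothing.
  by_cases hr : r ∈ indexSet d M
  · obtain ⟨s, hs, hrs, hal⟩ := exists_alias M hM r
    have h0 : (0 : Fin d → ℤ) ∈ indexSet d M := by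
      rw [mem_indexSet]; intro j; simp [hM]
    have := hal 0 h0
    rw [hrs hr, sub_zero] at this
    by_cases hr0 : r = 0
    · rw [if_pos (this.2 hr0.symm), if_pos hr0, hr0]
      field_simp
      simp
    · rw [if_neg fun h => hr0 (this.1 h).symm, if_neg hr0]
      simp
  · have hr0 : r ≠ 0 := by
      rintro rfl
      exact hr (by rw [mem_indexSet]; intro j; simp [hM])
    rw [Set.indicator_of_mem (by simpa using hr), if_neg hr0, sub_zero]
    split_ifs
    · refine le_of_eq ?_
      congr 1
      field_simp
    · simp

/-- Trigonometric interpolation on the grid, for an absolutely convergent Fourier series. -/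
theorem norm_interpolate_sub_le (M : ℕ) (hM : 0 < M) {c : (Fin d → ℤ) → ℂ}
    (hc : Summable fun r => ‖c r‖) {f : (Fin d → ℝ) → ℂ}
    (hf : ∀ n ∈ indexSet d M, HasSum (fun r => c r * mExp r (unitGrid M n)) (f (unitGrid M n)))
    (z : Fin d → ℝ) :
    ‖1 / (2 * (M : ℂ)) ^ d * ∑ n ∈ indexSet d M, ∑ p ∈ indexSet d M,
        mExp p (z - unitGrid M n) * f (unitGrid M n) - ∑' r, c r * mExp r z‖ ≤ 2 * tail c M := by
  have h1 : HasSum (fun r => 1 / (2 * (M : ℂ)) ^ d * ∑ n ∈ indexSet d M, ∑ p ∈ indexSet d M,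
        mExp p (z - unitGrid M n) * (c r * mExp r (unitGrid M n)))
      (1 / (2 * (M : ℂ)) ^ d * ∑ n ∈ indexSet d M, ∑ p ∈ indexSet d M,
        mExp p (z - unitGrid M n) * f (unitGrid M n)) :=
    (hasSum_sum fun n hn => hasSum_sum fun p _ => (hf n hn).mul_left _).mul_left _
  have h2 : Summable fun r => c r * mExp r z :=
    Summable.of_norm (by simpa [norm_mExp] using hc)
  rw [← (h1.sub h2.hasSum).tsum_eq]
  refine tsum_of_norm_bounded ((summable_norm_indicator hc _).hasSum.mul_left 2) fun r => ?_
  obtain ⟨s, hs, hrs, hint⟩ := interpolate_mExp (d := d) M hM r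
  have hterm : 1 / (2 * (M : ℂ)) ^ d * ∑ n ∈ indexSet d M, ∑ p ∈ indexSet d M,
        mExp p (z - unitGrid M n) * (c r * mExp r (unitGrid M n)) = c r * mExp s z := by
    rw [← hint z]
    simp only [mul_left_comm _ (c r), ← Finset.mul_sum]
  rw [hterm]
  -- Resolved monomials are reproduced exactly. An unresolved one costs itself and its alias, hence
  -- the factor `2`.
  by_cases hr : r ∈ indexSet d M
  · rw [hrs hr, sub_self, norm_zero]
    positivity
  · rw [Set.indicator_of_mem (by simpa using hr), two_mul]
    refine (norm_sub_le _ _).trans ?_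
    simp [norm_mExp]

end DiscreteFourier

/-! ### Rapid decay of Fourier coefficients, uniform in a parameter -/

section Decay

variable {d : ℕ}

/-- The inclusion of the second factor has norm at most `1`. Bounding by the joint derivative is
what permits compactness in `x` and `t` together. -/
theorem norm_iteratedFDeriv_partial_le {X Y F : Type*} [NormedAddCommGroup X] [NormedSpace ℝ X]
    [NormedAddCommGroup Y] [NormedSpace ℝ Y] [NormedAddCommGroup F] [NormedSpace ℝ F]
    {G : X × Y → F} (hG : ContDiff ℝ ∞ G) (i : ℕ) (x : X) (t : Y) :
    ‖iteratedFDeriv ℝ i (fun s => G (x, s)) t‖ ≤ ‖iteratedFDeriv ℝ i G (x, t)‖ := by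
  have h1 : (fun s => G (x, s)) =
      (fun z => G ((x, 0) + z)) ∘ (ContinuousLinearMap.inr ℝ X Y) := by
    funext s
    simp
  have hG' : ContDiff ℝ ∞ (fun z => G ((x, 0) + z)) := hG.comp (contDiff_const.add contDiff_id)
  rw [h1, ContinuousLinearMap.iteratedFDeriv_comp_right _ hG' t (by exact_mod_cast le_top)]
  refine (ContinuousMultilinearMap.norm_compContinuousLinearMap_le _ _).trans ?_
  rw [iteratedFDeriv_comp_add_left]
  have h2 : ‖ContinuousLinearMap.inr ℝ X Y‖ ≤ 1 :=
    ContinuousLinearMap.opNorm_le_bound _ zero_le_one fun y => by simp [Prod.norm_def]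
  simp only [Finset.prod_const, Finset.card_univ, Fintype.card_fin,
    ContinuousLinearMap.inr_apply, Prod.mk_add_mk, add_zero, zero_add]
  exact mul_le_of_le_one_right (norm_nonneg _) (pow_le_one₀ (norm_nonneg _) h2)

theorem exists_integral_iteratedFDeriv_le {X : Type*} [NormedAddCommGroup X] [NormedSpace ℝ X]
    {K : Set X} (hK : IsCompact K) {G : X × (Fin d → ℝ) → ℂ} (hG : ContDiff ℝ ∞ G)
    (h0 : ∀ x t, 1 / 2 < ‖t‖ → G (x, t) = 0) (i : ℕ) :
    ∃ C : ℝ, ∀ x ∈ K, Integrable (fun t => ‖iteratedFDeriv ℝ i (fun s => G (x, s)) t‖) ∧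
      ∫ t, ‖iteratedFDeriv ℝ i (fun s => G (x, s)) t‖ ≤ C := by
  set Q : Set (Fin d → ℝ) := Metric.closedBall 0 (1 / 2) with hQ
  have hQc : IsCompact Q := isCompact_closedBall _ _
  obtain ⟨C, hC⟩ := (hK.prod hQc).exists_bound_of_continuousOn
    (hG.continuous_iteratedFDeriv (m := i) (by exact_mod_cast le_top)).continuousOn
  have hind : Integrable (Q.indicator fun _ => C) :=
    (integrable_indicator_iff hQc.measurableSet).2
      (integrableOn_const hQc.measure_lt_top.ne)
  refine ⟨∫ t, Q.indicator (fun _ => C) t, fun x hx => ?_⟩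
  have hsm : ContDiff ℝ ∞ (fun s => G (x, s)) := hG.comp (contDiff_const.prodMk contDiff_id)
  have hcont : Continuous (fun t => ‖iteratedFDeriv ℝ i (fun s => G (x, s)) t‖) :=
    (hsm.continuous_iteratedFDeriv (m := i) (by exact_mod_cast le_top)).norm
  have hts : tsupport (fun s => G (x, s)) ⊆ Q := by
    refine closure_minimal (fun t ht => ?_) Metric.isClosed_closedBall
    rw [hQ, mem_closedBall_zero_iff]
    by_contra! h
    exact ht (h0 x t h)
  have hle : ∀ t, ‖iteratedFDeriv ℝ i (fun s => G (x, s)) t‖ ≤ Q.indicator (fun _ => C) t := by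
    intro t
    by_cases ht : t ∈ Q
    · rw [Set.indicator_of_mem ht]
      exact (norm_iteratedFDeriv_partial_le hG i x t).trans (hC _ ⟨hx, ht⟩)
    · rw [Set.indicator_of_notMem ht]
      have : iteratedFDeriv ℝ i (fun s => G (x, s)) t = 0 := by
        by_contra h
        exact ht (hts (support_iteratedFDeriv_subset i h))
      rw [this, norm_zero]
  have hint := hind.mono' hcont.aestronglyMeasurable (ae_of_all _ fun t => by simpa using hle t)
  exact ⟨hint, integral_mono hint hind hle⟩

/-- The Euclidean pairing on `ℝ^d` as a continuous bilinear form. -/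
noncomputable def dotCLM (d : ℕ) : (Fin d → ℝ) →L[ℝ] (Fin d → ℝ) →L[ℝ] ℝ :=
  ∑ j, (ContinuousLinearMap.proj (R := ℝ) (φ := fun _ : Fin d => ℝ) j).smulRight
    (ContinuousLinearMap.proj (R := ℝ) (φ := fun _ : Fin d => ℝ) j)

theorem dotCLM_apply (v w : Fin d → ℝ) : dotCLM d v w = ∑ j, v j * w j := by
  simp [dotCLM]

/-- Coefficients are samples of the Fourier integral at integer points, so derivative bounds for the
latter apply. -/
theorem coeff_eq_fourierIntegral (φ : (Fin d → ℝ) → ℂ) (r : Fin d → ℤ) :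
    coeff φ r = VectorFourier.fourierIntegral Real.fourierChar volume
      (dotCLM d).toLinearMap₁₂ φ (fun j => (r j : ℝ)) := by
  rw [coeff, VectorFourier.fourierIntegral]
  refine integral_congr_ae (ae_of_all _ fun t => ?_)
  have h : (dotCLM d).toLinearMap₁₂ t (fun j => (r j : ℝ)) = ∑ j, (r j : ℝ) * t j := by
    change dotCLM d t _ = _
    rw [dotCLM_apply]
    exact Finset.sum_congr rfl fun j _ => mul_comm _ _
  simp only [h, Circle.smul_def, Real.fourierChar_apply, smul_eq_mul, mExp, Pi.neg_apply]
  congr 2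
  push_cast
  simp only [neg_mul, Finset.sum_neg_distrib]
  ring

/-- The Fourier coefficients of a smooth family of functions supported in the unit cube decay
rapidly, uniformly for parameters in a compact set. -/
theorem exists_coeff_decay {X : Type*} [NormedAddCommGroup X] [NormedSpace ℝ X]
    {K : Set X} (hK : IsCompact K) {G : X × (Fin d → ℝ) → ℂ} (hG : ContDiff ℝ ∞ G)
    (h0 : ∀ x t, 1 / 2 < ‖t‖ → G (x, t) = 0) (n : ℕ) :
    ∃ B : ℝ, 0 ≤ B ∧ ∀ x ∈ K, ∀ r, ‖coeff (fun t => G (x, t)) r‖ ≤ B * ((1 + ‖r‖) ^ n)⁻¹ := by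
  choose C hC using exists_integral_iteratedFDeriv_le hK hG h0
  -- Derivatives up to order `m` control multiplication by the `m`-th power of `v · r` on the
  -- Fourier side.
  have main : ∀ (m : ℕ) (v : Fin d → ℝ), ∀ x ∈ K, ∀ r : Fin d → ℤ,
      |dotCLM d v (fun j => (r j : ℝ))| ^ m * ‖coeff (fun t => G (x, t)) r‖ ≤
        ‖v‖ ^ m * (2 ^ m * ∑ i ∈ Finset.range (m + 1), |C i|) := by
    intro m v x hx r
    have hsm : ContDiff ℝ ((⊤ : ℕ∞) : WithTop ℕ∞) (fun s => G (x, s)) :=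
      hG.comp (contDiff_const.prodMk contDiff_id)
    have key := VectorFourier.pow_mul_norm_iteratedFDeriv_fourierIntegral_le (dotCLM d)
      (μ := volume) (K := 0) (N := ⊤) hsm (by
        intro k i hk _
        have : k = 0 := by exact_mod_cast nonpos_iff_eq_zero.1 hk
        subst this
        simpa using (hC i x hx).1) (k := 0) (n := m) le_rfl le_top v (fun j => (r j : ℝ))
    rw [norm_iteratedFDeriv_zero, ← coeff_eq_fourierIntegral] at key
    refine key.trans ?_
    simp only [pow_zero, mul_one, Nat.cast_zero, mul_zero, zero_add, Finset.range_one, mul_assoc]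
    gcongr
    rw [Finset.sum_product, Finset.sum_singleton]
    refine Finset.sum_le_sum fun i _ => ?_
    simpa using (hC i x hx).2.trans (le_abs_self _)
  set D : ℕ → ℝ := fun m => 2 ^ m * ∑ i ∈ Finset.range (m + 1), |C i| with hD
  have hDnn : ∀ m, 0 ≤ D m := fun m => by positivity
  refine ⟨2 ^ n * (D 0 + D n), by have := hDnn 0; have := hDnn n; positivity,
    fun x hx r => ?_⟩
  have hpos : 0 < (1 + ‖r‖) ^ n := by positivity
  rw [← div_eq_mul_inv, le_div_iff₀ hpos]
  set c := ‖coeff (fun t => G (x, t)) r‖ with hc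
  have hc0 : 0 ≤ c := norm_nonneg _
  rcases le_or_gt ‖r‖ 1 with hr | hr
  · have h1 := main 0 0 x hx r
    rw [pow_zero, pow_zero, one_mul, one_mul] at h1
    calc c * (1 + ‖r‖) ^ n ≤ D 0 * 2 ^ n := by
          gcongr
          linarith
      _ ≤ 2 ^ n * (D 0 + D n) := by nlinarith [hDnn n, pow_pos (two_pos (α := ℝ)) n]
  -- Differentiate along the largest coordinate of `r`; since `‖r‖ > 1`, `1 + ‖r‖ ≤ 2 |r j|`. The
  -- case `‖r‖ ≤ 1` needed only order `0`.
  · obtain ⟨j, hj⟩ : ∃ j, ‖r‖ ≤ ‖r j‖ := by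
      by_contra! h
      exact lt_irrefl _ ((pi_norm_lt_iff (by linarith)).2 h)
    have h1 := main n (Pi.single j 1) x hx r
    have h2 : dotCLM d (Pi.single j 1) (fun j => (r j : ℝ)) = r j := by
      simp [dotCLM_apply, Pi.single_apply]
    have h3 : ‖(Pi.single j 1 : Fin d → ℝ)‖ = 1 := by
      rw [Pi.norm_single, norm_one]
    rw [h2, h3, one_pow, one_mul] at h1
    rw [Int.norm_eq_abs] at hj
    calc c * (1 + ‖r‖) ^ n ≤ c * (2 * |(r j : ℝ)|) ^ n := by
          gcongr
          linarith
      _ = 2 ^ n * (|(r j : ℝ)| ^ n * c) := by rw [mul_pow]; ring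
      _ ≤ 2 ^ n * (D 0 + D n) := by
          gcongr
          linarith [hDnn 0]

/-- Comparison with the lattice sum of `‖r‖ ^ -(d + 1)`, convergent because the exponent exceeds the
rank `d`. -/
theorem summable_one_add_norm_pow_inv (d : ℕ) :
    Summable fun r : Fin d → ℤ => ((1 + ‖r‖) ^ (d + 1))⁻¹ := by
  set b := Pi.basisFun ℝ (Fin d) with hb
  set Λ := Submodule.span ℤ (Set.range b) with hΛ
  have hmem : ∀ r : Fin d → ℤ, (fun j => (r j : ℝ)) ∈ Λ := fun r =>
    (Submodule.mem_span_range_iff_exists_fun ℤ).2 ⟨r, by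
      funext j
      simp [hb, Finset.sum_apply, Pi.single_apply]⟩
  have hsum := ZLattice.summable_norm_pow_inv Λ (d + 1) (by
    rw [ZLattice.rank ℝ Λ]; simp)
  have hinj : Function.Injective fun r : Fin d → ℤ => (⟨fun j => (r j : ℝ), hmem r⟩ : Λ) := by
    intro r s h
    funext j
    have : (r j : ℝ) = s j := congrFun (congrArg Subtype.val h) j
    exact_mod_cast this
  have h1 := hsum.comp_injective hinj
  -- The comparison fails at `r = 0`, where the inverse norm is `0` by convention.
  refine Summable.of_norm_bounded_eventually h1 ?_
  filter_upwards [(Set.finite_singleton (0 : Fin d → ℤ)).compl_mem_cofinite] with r hr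
  have hr0 : 0 < ‖r‖ := norm_pos_iff.2 hr
  have hn : ‖(⟨fun j => (r j : ℝ), hmem r⟩ : Λ)‖ = ‖r‖ := by
    change ‖(fun j => (r j : ℝ))‖ = ‖r‖
    simp only [Pi.norm_def]
    congr 2
  simp only [Function.comp_apply, hn]
  rw [Real.norm_of_nonneg (by positivity), inv_pow]
  gcongr
  exact le_add_of_nonneg_left zero_le_one

theorem summable_of_decay {c : (Fin d → ℤ) → ℂ} {B : ℝ}
    (hc : ∀ r, ‖c r‖ ≤ B * ((1 + ‖r‖) ^ (d + 1))⁻¹) : Summable fun r => ‖c r‖ :=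
  Summable.of_nonneg_of_le (fun _ => norm_nonneg _) hc
    ((summable_one_add_norm_pow_inv d).mul_left B)

/-- Outside the index set `‖r‖ ≥ M`: `m` powers of the decay give the rate and the other `d + 1`
keep the sum finite. -/
theorem tail_le_of_decay {c : (Fin d → ℤ) → ℂ} {B : ℝ} (hB : 0 ≤ B) {m : ℕ}
    (hc : ∀ r, ‖c r‖ ≤ B * ((1 + ‖r‖) ^ (m + (d + 1)))⁻¹) {M : ℕ} (hM : 0 < M) :
    tail c M ≤ B * (∑' r : Fin d → ℤ, ((1 + ‖r‖) ^ (d + 1))⁻¹) * ((M : ℝ) ^ m)⁻¹ := by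
  have hs := (summable_one_add_norm_pow_inv d).hasSum.mul_left (B * ((M : ℝ) ^ m)⁻¹)
  have hle : ∀ r, ‖(indexSet d M : Set (Fin d → ℤ))ᶜ.indicator c r‖ ≤
      B * ((M : ℝ) ^ m)⁻¹ * ((1 + ‖r‖) ^ (d + 1))⁻¹ := by
    intro r
    by_cases hr : r ∈ indexSet d M
    · rw [Set.indicator_of_notMem (by simpa using hr), norm_zero]
      positivity
    · rw [Set.indicator_of_mem (by simpa using hr)]
      refine (hc r).trans ?_
      rw [pow_add, mul_inv, ← mul_assoc]
      have hMr : (M : ℝ) ≤ ‖r‖ := by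
        rw [mem_indexSet] at hr
        push Not at hr
        obtain ⟨j, hj⟩ := hr
        refine le_trans ?_ (norm_le_pi_norm r j)
        rw [Int.norm_eq_abs]
        have : (M : ℤ) ≤ |r j| := by
          rcases le_or_gt (-(M : ℤ)) (r j) with h | h
          · exact (hj h).trans (le_abs_self _)
          · exact le_trans (by linarith) (neg_le_abs _)
        exact_mod_cast this
      have hM' : (0 : ℝ) < M := by exact_mod_cast hM
      gcongr
      linarith
  calc tail c M ≤ B * ((M : ℝ) ^ m)⁻¹ * ∑' r : Fin d → ℤ, ((1 + ‖r‖) ^ (d + 1))⁻¹ :=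
        hasSum_le hle (Summable.of_nonneg_of_le (fun _ => norm_nonneg _) hle hs.summable).hasSum hs
    _ = _ := by ring

end Decay

/-! ### Rescaling the box and excluding periodic images -/

section Geometry

variable {d : ℕ}

/-- The diagonal map `t ↦ (T_1 t_1, …, T_d t_d)` into Euclidean space. -/
noncomputable def scale (T : Fin d → ℝ) : (Fin d → ℝ) →L[ℝ] EuclideanSpace ℝ (Fin d) :=
  ((EuclideanSpace.equiv (Fin d) ℝ).symm : (Fin d → ℝ) →L[ℝ] EuclideanSpace ℝ (Fin d)).comp
    (ContinuousLinearMap.pi fun j => T j • ContinuousLinearMap.proj j)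

theorem scale_apply (T t : Fin d → ℝ) (j : Fin d) : scale T t j = T j * t j := by
  simp [scale]

/-- The coordinatewise quotient `z ↦ (z_1 / T_1, …, z_d / T_d)`. -/
noncomputable def unscale (T : Fin d → ℝ) (z : EuclideanSpace ℝ (Fin d)) : Fin d → ℝ :=
  fun j => z j / T j

theorem scale_unscale {T : Fin d → ℝ} (hT : ∀ j, 0 < T j) (z : EuclideanSpace ℝ (Fin d)) :
    scale T (unscale T z) = z := by
  ext j
  rw [scale_apply, unscale, mul_div_cancel₀ _ (hT j).ne']

theorem unscale_scale {T : Fin d → ℝ} (hT : ∀ j, 0 < T j) (t : Fin d → ℝ) :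
    unscale T (scale T t) = t := by
  funext j
  rw [unscale, scale_apply, mul_div_cancel_left₀ _ (hT j).ne']

theorem unscale_sub (T : Fin d → ℝ) (x y : EuclideanSpace ℝ (Fin d)) :
    unscale T (x - y) = unscale T x - unscale T y := by
  funext j
  simp [unscale, sub_div]

theorem continuous_unscale (T : Fin d → ℝ) : Continuous (unscale T) := by
  unfold unscale
  fun_prop

theorem integral_eq_prod_mul_integral_scale {T : Fin d → ℝ} (hT : ∀ j, 0 < T j)
    {f : EuclideanSpace ℝ (Fin d) → ℂ} (hf : Continuous f) :
    ∫ y, f y = ((∏ j, T j : ℝ) : ℂ) * ∫ t, f (scale T t) := by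
  classical
  have hprod : 0 < ∏ j, T j := Finset.prod_pos fun j _ => hT j
  have h1 : ∫ y, f y = ∫ s : Fin d → ℝ, f (WithLp.toLp 2 s) :=
    ((PiLp.volume_preserving_toLp (Fin d)).integral_comp
      (MeasurableEquiv.toLp 2 (Fin d → ℝ)).measurableEmbedding f).symm
  have hdet : (Matrix.diagonal T).det = ∏ j, T j := Matrix.det_diagonal
  have hvol := Real.smul_map_diagonal_volume_pi (D := T) (by rw [hdet]; exact hprod.ne')
  rw [hdet, abs_of_pos hprod] at hvol
  have hcont : Continuous fun s : Fin d → ℝ => f (WithLp.toLp 2 s) :=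
    hf.comp (PiLp.continuous_toLp 2 _)
  rw [h1, ← hvol, integral_smul_measure, ENNReal.toReal_ofReal hprod.le,
    integral_map (by
      exact (LinearMap.continuous_of_finiteDimensional _).aemeasurable)
      hcont.aestronglyMeasurable, Complex.real_smul]
  congr 1
  rw [hvol]
  refine integral_congr_ae (ae_of_all _ fun t => congrArg f ?_)
  ext j
  simp [scale_apply, Matrix.mulVec_diagonal]

theorem isCompact_box (L : ℝ) (γ : Fin d → ℝ) : IsCompact (box L γ) := by
  have h := (isCompact_univ_pi fun j => isCompact_Icc (a := -(L * γ j)) (b := L * γ j)).image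
    (PiLp.continuous_toLp 2 fun _ : Fin d => ℝ)
  convert h using 1
  ext x
  constructor
  · exact fun hx => ⟨x.ofLp, fun j _ => hx j, rfl⟩
  · rintro ⟨y, hy, rfl⟩ j
    exact hy j trivial

/-- A continuous function supported in the closed box vanishes on and beyond its faces. -/
theorem eq_zero_of_le_abs {L : ℝ} {γ : Fin d → ℝ} {ρ : EuclideanSpace ℝ (Fin d) → ℝ}
    (hρ : Continuous ρ) (hsupp : tsupport ρ ⊆ box L γ) {z : EuclideanSpace ℝ (Fin d)} {j : Fin d}
    (hz : L * γ j ≤ |z j|) : ρ z = 0 := by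
  by_contra hne
  have hcont : Continuous fun s : ℝ => ρ (z + s • EuclideanSpace.single j (1 : ℝ)) := by fun_prop
  -- A nonzero value would persist under small shifts along `e_j` both ways, one of which leaves the
  -- box.
  have hev : ∀ᶠ s in 𝓝 (0 : ℝ), ρ (z + s • EuclideanSpace.single j (1 : ℝ)) ≠ 0 :=
    hcont.continuousAt.eventually_ne (by simpa using hne)
  obtain ⟨δ, hδ, H⟩ := Metric.eventually_nhds_iff.1 hev
  have hbox : ∀ s : ℝ, |s| < δ → |z j + s| ≤ L * γ j := by
    intro s hs
    have := hsupp (subset_tsupport _ (H (y := s) (by simpa using hs))) j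
    rw [abs_le]
    simpa using this
  have h1 := hbox (δ / 2) (by rw [abs_of_pos] <;> linarith)
  have h2 := hbox (-(δ / 2)) (by rw [abs_neg, abs_of_pos] <;> linarith)
  rw [abs_le] at h1 h2
  rcases abs_cases (z j) with h | h <;> linarith [h1.1, h1.2, h2.1, h2.2]

theorem hasCompactSupport_of_box {L : ℝ} {γ : Fin d → ℝ} {ρ : EuclideanSpace ℝ (Fin d) → ℝ}
    (hsupp : tsupport ρ ⊆ box L γ) : HasCompactSupport ρ :=
  (isCompact_box L γ).of_isClosed_subset (isClosed_tsupport ρ) hsupp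

/-- The Fourier series of a function supported in the middle half of the unit cube reproduces that
function on the cube enlarged by the factor `3 / 2`. -/
theorem hasSum_of_mem_enlarged_cube {φ : (Fin d → ℝ) → ℂ} (hφ : Continuous φ)
    (h0 : ∀ t, (∃ j, 1 / 4 ≤ |t j|) → φ t = 0) (hs : Summable (coeff φ))
    {z : Fin d → ℝ} (hz : ∀ j, |z j| ≤ 3 / 4) :
    HasSum (fun r => coeff φ r * mExp r z) (φ z) := by
  have h0' : ∀ t, (∃ j, 1 / 2 ≤ |t j|) → φ t = 0 := fun t ⟨j, hj⟩ => h0 t ⟨j, by linarith⟩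
  have h1 := hasSum_coeff_mul_mExp hφ h0' hs (t := fun j => z j - round (z j))
    fun j => abs_sub_round (z j)
  have hper : ∀ r, mExp r (fun j => z j - round (z j)) = mExp r z := by
    intro r
    rw [← mFourier_coe, ← mFourier_coe]
    congr 1
    funext j
    rw [AddCircle.coe_sub, sub_eq_self, AddCircle.coe_eq_zero_iff]
    exact ⟨round (z j), by simp⟩
  simp only [hper] at h1
  convert h1 using 1
  by_cases hq : ∀ j, round (z j) = 0
  · simp [hq]
  -- If `round (z j) ≠ 0`, then `|z j| ≥ 1/2`, while the reduced coordinate is at least `1 - 3/4 =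
  -- 1/4` in size: `φ` vanishes at both points.
  · push Not at hq
    obtain ⟨j, hj⟩ := hq
    have hj1 : (1 : ℝ) ≤ |(round (z j) : ℝ)| := by exact_mod_cast Int.one_le_abs hj
    have h2 := abs_sub_abs_le_abs_sub (round (z j) : ℝ) (z j)
    have h3 := abs_sub_round (z j)
    rw [abs_sub_comm] at h2
    rw [h0 z ⟨j, by linarith⟩, h0 _ ⟨j, by linarith [hz j]⟩]

end Geometry

/-! ### Integrability of the residual kernel and its far-field mass -/

section Radial

variable {d : ℕ}

/-- The residual kernel outside the ball of radius `R₀`. -/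
noncomputable def farResidual (R₀ : ℝ) (u v : ℝ → ℝ) : ℝ → ℝ :=
  (Set.Ioi R₀).indicator fun r => |u r - v r|

theorem integrable_farResidual (hd : 0 < d) {R₀ εtol : ℝ} {u v : ℝ → ℝ}
    (h : IsFarFieldApprox d R₀ εtol u v) :
    Integrable fun y : EuclideanSpace ℝ (Fin d) => farResidual R₀ u v ‖y‖ := by
  have : Nonempty (Fin d) := ⟨⟨0, hd⟩⟩
  rw [integrable_fun_norm_addHaar (μ := volume) (f := farResidual R₀ u v)]
  have h1 : (fun y : ℝ => y ^ (Module.finrank ℝ (EuclideanSpace ℝ (Fin d)) - 1) •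
      farResidual R₀ u v y) = (Set.Ioi R₀).indicator fun r => |u r - v r| * r ^ (d - 1) := by
    funext y
    by_cases hy : y ∈ Set.Ioi R₀ <;> simp [farResidual, hy, mul_comm]
  rw [h1]
  exact ((integrable_indicator_iff measurableSet_Ioi).2 h.tail_integrable).integrableOn

/-- Polar coordinates: `d` times the volume of the unit ball is the area of the unit sphere. -/
theorem integral_farResidual_le (hd : 0 < d) {R₀ εtol : ℝ} (hR : 0 ≤ R₀) {u v : ℝ → ℝ}
    (h : IsFarFieldApprox d R₀ εtol u v) :
    ∫ y : EuclideanSpace ℝ (Fin d), farResidual R₀ u v ‖y‖ ≤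
      d * volume.real (Metric.ball (0 : EuclideanSpace ℝ (Fin d)) 1) * εtol := by
  have : Nonempty (Fin d) := ⟨⟨0, hd⟩⟩
  rw [integral_fun_norm_addHaar volume (farResidual R₀ u v)]
  have h1 : (fun y : ℝ => y ^ (Module.finrank ℝ (EuclideanSpace ℝ (Fin d)) - 1) •
      farResidual R₀ u v y) = (Set.Ioi R₀).indicator fun r => |u r - v r| * r ^ (d - 1) := by
    funext y
    by_cases hy : y ∈ Set.Ioi R₀ <;> simp [farResidual, hy, mul_comm]
  rw [h1, setIntegral_indicator measurableSet_Ioi, Set.inter_eq_right.2 (Set.Ioi_subset_Ioi hR),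
    nsmul_eq_mul, smul_eq_mul, finrank_euclideanSpace_fin, mul_assoc]
  gcongr
  exact h.tail_le

/-- Local integrability handles the ball of radius `R₀`, the tail condition its complement. -/
theorem integrable_residual (hd : 0 < d) {R₀ εtol : ℝ} {u v : ℝ → ℝ}
    (hu : LocallyIntegrable fun x : EuclideanSpace ℝ (Fin d) => u ‖x‖)
    (h : IsFarFieldApprox d R₀ εtol u v) :
    Integrable fun y : EuclideanSpace ℝ (Fin d) => u ‖y‖ - v ‖y‖ := by
  have hloc : LocallyIntegrable fun y : EuclideanSpace ℝ (Fin d) => u ‖y‖ - v ‖y‖ :=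
    hu.sub h.smooth.continuous.locallyIntegrable
  have hin := (hloc.integrableOn_isCompact
    (isCompact_closedBall (0 : EuclideanSpace ℝ (Fin d)) R₀)).integrable_indicator
    measurableSet_closedBall
  refine Integrable.mono' (hin.norm.add (integrable_farResidual hd h))
    hloc.aestronglyMeasurable (ae_of_all _ fun y => ?_)
  by_cases hy : ‖y‖ ≤ R₀
  · have : y ∈ Metric.closedBall (0 : EuclideanSpace ℝ (Fin d)) R₀ := by simpa using hy
    simp [farResidual, this, hy]
  · have : y ∉ Metric.closedBall (0 : EuclideanSpace ℝ (Fin d)) R₀ := by simpa using hy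
    simp [farResidual, this, not_le.1 hy]

theorem integrable_translate_mul {u : ℝ → ℝ} {ρ : EuclideanSpace ℝ (Fin d) → ℝ}
    (hu : LocallyIntegrable fun x : EuclideanSpace ℝ (Fin d) => u ‖x‖)
    (hρ : Continuous ρ) (hc : HasCompactSupport ρ) (x : EuclideanSpace ℝ (Fin d)) :
    Integrable fun y => u ‖x - y‖ * ρ y := by
  have h1 : Continuous fun y => ρ (x - y) := hρ.comp (continuous_const.sub continuous_id)
  have h2 : HasCompactSupport fun y => ρ (x - y) :=
    hc.comp_homeomorph (Homeomorph.subLeft x)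
  have h3 := (hu.integrable_smul_left_of_hasCompactSupport h1 h2).comp_sub_left x
  simpa [mul_comm] using h3

theorem innerRadius_le (L : ℝ) (γ : Fin d → ℝ) (j : Fin d) :
    innerRadius L γ ≤ 2 * L * γ j :=
  ciInf_le (Set.finite_range _).bddBelow j

theorem innerRadius_nonneg {L : ℝ} (hL : 0 < L) {γ : Fin d → ℝ} (hγ : ∀ j, 0 < γ j) :
    0 ≤ innerRadius L γ :=
  Real.iInf_nonneg fun j => by have := hγ j; positivity

end Radial

/-! ### Error of the residual part -/

section Error

variable {d : ℕ} {L : ℝ} {γ : Fin d → ℝ} {ρ : EuclideanSpace ℝ (Fin d) → ℝ}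

theorem exp_fourierMode (p : Fin d → ℤ) (z : EuclideanSpace ℝ (Fin d)) :
    Complex.exp (Complex.I * ((∑ j, fourierMode L γ p j * z j : ℝ) : ℂ)) =
      mExp p (unscale (fun j => 4 * L * γ j) z) := by
  rw [mExp]
  congr 1
  push_cast
  rw [Finset.mul_sum, Finset.mul_sum]
  refine Finset.sum_congr rfl fun j _ => ?_
  simp only [fourierMode, unscale]
  push_cast
  rw [show (4 : ℂ) * L * γ j = 2 * (2 * L * γ j) by ring]
  simp only [div_eq_mul_inv, mul_inv]
  ring

theorem exp_neg_fourierMode (p : Fin d → ℤ) (z : EuclideanSpace ℝ (Fin d)) :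
    Complex.exp (-(Complex.I * ((∑ j, fourierMode L γ p j * z j : ℝ) : ℂ))) =
      mExp p (-unscale (fun j => 4 * L * γ j) z) := by
  rw [show -unscale (fun j => 4 * L * γ j) z = unscale (fun j => 4 * L * γ j) (-z) by
    funext j; simp [unscale, neg_div], ← exp_fourierMode]
  congr 1
  simp

/-- The same mesh has `2N` points per direction on the doubled box (residual part) and `N` on the
original one (smooth part, `scale_unitGrid`). -/
theorem scale_unitGrid_double (N : ℕ) (n : Fin d → ℤ) :
    scale (fun j => 4 * L * γ j) (unitGrid N n) = gridPoint L γ N n := by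
  ext j
  simp only [scale_apply, unitGrid, gridPoint, meshSize]
  rw [show (4 : ℝ) * L * γ j = 2 * (2 * L * γ j) by ring]
  simp only [div_eq_mul_inv, mul_inv]
  ring

theorem scale_unitGrid (M : ℕ) (n : Fin d → ℤ) :
    scale (fun j => 2 * L * γ j) (unitGrid M n) = gridPoint L γ (2 * M) n := by
  ext j
  simp only [scale_apply, unitGrid, gridPoint, meshSize, div_eq_mul_inv]
  push_cast
  ring

/-- The density on the doubled box, rescaled to the unit cube. -/
noncomputable def rescaledDensity (L : ℝ) (γ : Fin d → ℝ) (ρ : EuclideanSpace ℝ (Fin d) → ℝ)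
    (t : Fin d → ℝ) : ℂ :=
  ((ρ (scale (fun j => 4 * L * γ j) t) : ℝ) : ℂ)

theorem continuous_rescaledDensity (hρ : Continuous ρ) : Continuous (rescaledDensity L γ ρ) := by
  unfold rescaledDensity
  fun_prop

theorem rescaledDensity_eq_zero (hL : 0 < L) (hγ : ∀ j, 0 < γ j) (hρ : Continuous ρ)
    (hsupp : tsupport ρ ⊆ box L γ) {t : Fin d → ℝ} (ht : ∃ j, 1 / 4 ≤ |t j|) :
    rescaledDensity L γ ρ t = 0 := by
  obtain ⟨j, hj⟩ := ht
  have hpos : 0 < L * γ j := mul_pos hL (hγ j)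
  rw [rescaledDensity, eq_zero_of_le_abs hρ hsupp (j := j), Complex.ofReal_zero]
  rw [scale_apply, abs_mul, abs_of_pos (by linarith)]
  nlinarith

/-- The trigonometric interpolant of the rescaled density on the doubled grid. -/
noncomputable def interpolant (L : ℝ) (γ : Fin d → ℝ) (ρ : EuclideanSpace ℝ (Fin d) → ℝ) (N : ℕ)
    (z : Fin d → ℝ) : ℂ :=
  1 / (2 * (N : ℂ)) ^ d * ∑ n ∈ indexSet d N, ∑ p ∈ indexSet d N,
    mExp p (z - unitGrid N n) * rescaledDensity L γ ρ (unitGrid N n)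

theorem continuous_interpolant (N : ℕ) : Continuous (interpolant L γ ρ N) := by
  unfold interpolant
  have := fun p : Fin d → ℤ => continuous_mExp p
  fun_prop

theorem exists_norm_interpolant_le (N : ℕ) : ∃ C : ℝ, ∀ z, ‖interpolant L γ ρ N z‖ ≤ C := by
  refine ⟨‖1 / (2 * (N : ℂ)) ^ d‖ * ∑ n ∈ indexSet d N, ∑ p ∈ indexSet d N,
    ‖rescaledDensity L γ ρ (unitGrid N n)‖, fun z => ?_⟩
  rw [interpolant, norm_mul]
  gcongr
  refine norm_sum_le_of_le _ fun n _ => norm_sum_le_of_le _ fun p _ => ?_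
  rw [norm_mul, norm_mExp, one_mul]

theorem residualFourier_mul_exp (u v : ℝ → ℝ) (p : Fin d → ℤ) (z : EuclideanSpace ℝ (Fin d)) :
    residualFourier u v (fourierMode L γ p) *
        Complex.exp (Complex.I * ((∑ j, fourierMode L γ p j * z j : ℝ) : ℂ)) =
      ∫ y : EuclideanSpace ℝ (Fin d), ((u ‖y‖ - v ‖y‖ : ℝ) : ℂ) *
        mExp p (unscale (fun j => 4 * L * γ j) (z - y)) := by
  rw [residualFourier, ← integral_mul_const]
  refine integral_congr_ae (ae_of_all _ fun y => ?_)
  simp only []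
  rw [exp_neg_fourierMode, exp_fourierMode, unscale_sub, sub_eq_add_neg (unscale _ z),
    mExp_add_right, mul_assoc, mul_comm (mExp p (unscale _ z))]

theorem integrable_residual_mul_of_bounded {u v : ℝ → ℝ}
    (hW : Integrable fun y : EuclideanSpace ℝ (Fin d) => u ‖y‖ - v ‖y‖)
    {g : EuclideanSpace ℝ (Fin d) → ℂ} (hg : Continuous g) {C : ℝ} (hC : ∀ y, ‖g y‖ ≤ C) :
    Integrable fun y : EuclideanSpace ℝ (Fin d) => ((u ‖y‖ - v ‖y‖ : ℝ) : ℂ) * g y :=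
  hW.ofReal.mul_bdd hg.aestronglyMeasurable (ae_of_all _ hC)

theorem continuous_mExp_unscale_sub (p : Fin d → ℤ) (z : EuclideanSpace ℝ (Fin d)) :
    Continuous fun y => mExp p (unscale (fun j => 4 * L * γ j) (z - y)) :=
  (continuous_mExp p).comp ((continuous_unscale _).comp (continuous_const.sub continuous_id))

/-- The Fourier part of the discrete convolution is the exact convolution of the residual kernel
with the trigonometric interpolant of the density. -/
theorem sum_fourier_part_eq_integral (hL : 0 < L) (hγ : ∀ j, 0 < γ j) (hρ : Continuous ρ)
    (hsupp : tsupport ρ ⊆ box L γ) {u v : ℝ → ℝ}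
    (hW : Integrable fun y : EuclideanSpace ℝ (Fin d) => u ‖y‖ - v ‖y‖) {N : ℕ} (hN : 0 < N)
    (heven : Even N) (x : EuclideanSpace ℝ (Fin d)) :
    ∑ n ∈ indexSet d (N / 2), (1 / (2 * (N : ℂ)) ^ d * ∑ p ∈ indexSet d N,
      residualFourier u v (fourierMode L γ p) * Complex.exp (Complex.I *
        ((∑ j, fourierMode L γ p j * (x - gridPoint L γ N n) j : ℝ) : ℂ))) *
          ((ρ (gridPoint L γ N n) : ℝ) : ℂ) =
      ∫ y : EuclideanSpace ℝ (Fin d), ((u ‖y‖ - v ‖y‖ : ℝ) : ℂ) *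
        interpolant L γ ρ N (unscale (fun j => 4 * L * γ j) (x - y)) := by
  have hT : ∀ j, 0 < 4 * L * γ j := fun j => by have := hγ j; positivity
  have hN' : (0 : ℝ) < N := by exact_mod_cast hN
  have hgrid : ∀ n, ((ρ (gridPoint L γ N n) : ℝ) : ℂ) = rescaledDensity L γ ρ (unitGrid N n) := by
    intro n
    rw [rescaledDensity, scale_unitGrid_double]
  have hsub : indexSet d (N / 2) ⊆ indexSet d N := by
    intro n hn
    rw [mem_indexSet] at hn ⊢
    intro j
    have := hn j
    omega
  -- The added grid points lie on or beyond the faces of the box, where `ρ` vanishes; evenness of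
  -- `N` places the cut at `|n j| ≥ N/2`.
  rw [Finset.sum_subset hsub]
  swap
  · intro n _ hn
    rw [hgrid, rescaledDensity_eq_zero hL hγ hρ hsupp, mul_zero]
    rw [mem_indexSet] at hn
    push Not at hn
    obtain ⟨j, hj⟩ := hn
    refine ⟨j, ?_⟩
    obtain ⟨k, hk⟩ := heven
    have h2 : (N : ℤ) ≤ 2 * |n j| := by
      rcases le_or_gt (-((N / 2 : ℕ) : ℤ)) (n j) with h | h
      · have := hj h
        have := le_abs_self (n j)
        omega
      · have := neg_le_abs (n j)
        omega
    have h3 : (N : ℝ) ≤ 2 * |(n j : ℝ)| := by exact_mod_cast h2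
    rw [unitGrid, abs_div, abs_of_pos (by positivity : (0 : ℝ) < 2 * N), le_div_iff₀ (by positivity)]
    linarith
  simp only [residualFourier_mul_exp, hgrid]
  have hint : ∀ n p, Integrable fun y : EuclideanSpace ℝ (Fin d) =>
      ((u ‖y‖ - v ‖y‖ : ℝ) : ℂ) *
        mExp p (unscale (fun j => 4 * L * γ j) (x - gridPoint L γ N n - y)) := fun n p =>
    integrable_residual_mul_of_bounded hW (continuous_mExp_unscale_sub p _)
      fun y => (norm_mExp _ _).le
  simp only [← integral_finsetSum _ fun p _ => hint _ p, ← integral_const_mul, ← integral_mul_const]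
  rw [← integral_finsetSum]
  · refine integral_congr_ae (ae_of_all _ fun y => ?_)
    simp only [interpolant, ← Finset.mul_sum, mul_assoc]
    rw [mul_left_comm, Finset.mul_sum, Finset.mul_sum, Finset.mul_sum, Finset.mul_sum]
    refine Finset.sum_congr rfl fun n _ => ?_
    rw [← Finset.sum_mul]
    have : ∀ p, mExp p (unscale (fun j => 4 * L * γ j) (x - gridPoint L γ N n - y)) =
        mExp p (unscale (fun j => 4 * L * γ j) (x - y) - unitGrid N n) := by
      intro p
      rw [sub_right_comm, unscale_sub _ (x - y), ← scale_unitGrid_double, unscale_scale hT]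
    simp only [mul_assoc] at this
    simp only [this]
  · intro n _
    exact ((integrable_finsetSum _ fun p _ => hint n p).const_mul _).mul_const _

/-- Error of the Fourier part: spectral interpolation error, plus the far-field contribution of the
periodic images. -/
theorem norm_fourier_part_sub_le (hd : 0 < d) (hL : 0 < L) (hγ : ∀ j, 0 < γ j)
    (hρ : Continuous ρ) (hsupp : tsupport ρ ⊆ box L γ)
    (hc : Summable fun r => ‖coeff (rescaledDensity L γ ρ) r‖) {S : ℝ} (hS : ∀ z, ‖ρ z‖ ≤ S)
    {u v : ℝ → ℝ} {εtol : ℝ}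
    (hu : LocallyIntegrable fun x : EuclideanSpace ℝ (Fin d) => u ‖x‖)
    (h : IsFarFieldApprox d (innerRadius L γ) εtol u v) {N : ℕ} (hN : 0 < N)
    {x : EuclideanSpace ℝ (Fin d)} (hx : x ∈ box L γ) :
    ‖∫ y : EuclideanSpace ℝ (Fin d), ((u ‖y‖ - v ‖y‖ : ℝ) : ℂ) *
        (((ρ (x - y) : ℝ) : ℂ) - interpolant L γ ρ N (unscale (fun j => 4 * L * γ j) (x - y)))‖ ≤
      2 * (∫ y : EuclideanSpace ℝ (Fin d), ‖u ‖y‖ - v ‖y‖‖) *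
          tail (coeff (rescaledDensity L γ ρ)) N +
        (S + ∑' r, ‖coeff (rescaledDensity L γ ρ) r‖) *
          (d * volume.real (Metric.ball (0 : EuclideanSpace ℝ (Fin d)) 1)) * εtol := by
  have hT : ∀ j, 0 < 4 * L * γ j := fun j => by have := hγ j; positivity
  set T : Fin d → ℝ := fun j => 4 * L * γ j with hTdef
  set c := coeff (rescaledDensity L γ ρ) with hcdef
  set τ := tail c N with hτ
  have hφ : Continuous (rescaledDensity L γ ρ) := continuous_rescaledDensity hρ
  have h0 : ∀ t, (∃ j, 1 / 4 ≤ |t j|) → rescaledDensity L γ ρ t = 0 :=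
    fun t ht => rescaledDensity_eq_zero hL hγ hρ hsupp ht
  have hW := integrable_residual hd hu h
  have hF := integrable_farResidual hd h
  have hτ0 : 0 ≤ τ := tsum_nonneg fun _ => norm_nonneg _
  have hK0 : 0 ≤ S + ∑' r, ‖c r‖ :=
    add_nonneg ((norm_nonneg _).trans (hS 0)) (tsum_nonneg fun _ => norm_nonneg _)
  have hinterp : ∀ z, ‖interpolant L γ ρ N z - ∑' r, c r * mExp r z‖ ≤ 2 * τ := by
    intro z
    refine norm_interpolate_sub_le N hN hc (fun n hn => ?_) z
    refine hasSum_of_mem_enlarged_cube hφ h0 hc.of_norm fun j => ?_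
    have hN' : (0 : ℝ) < N := by exact_mod_cast hN
    have hnj : |(n j : ℝ)| ≤ N := by
      have := mem_indexSet.1 hn j
      exact_mod_cast abs_le.2 ⟨this.1, this.2.le⟩
    rw [unitGrid, abs_div, abs_of_pos (by positivity : (0 : ℝ) < 2 * N), div_le_iff₀ (by positivity)]
    linarith
  have hpt : ∀ y : EuclideanSpace ℝ (Fin d),
      ‖((u ‖y‖ - v ‖y‖ : ℝ) : ℂ) * (((ρ (x - y) : ℝ) : ℂ) - interpolant L γ ρ N (unscale T (x - y)))‖
        ≤ 2 * τ * ‖u ‖y‖ - v ‖y‖‖ +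
          (S + ∑' r, ‖c r‖) * farResidual (innerRadius L γ) u v ‖y‖ := by
    intro y
    set z := unscale T (x - y) with hz
    have hρz : ((ρ (x - y) : ℝ) : ℂ) = rescaledDensity L γ ρ z := by
      rw [rescaledDensity, hz, scale_unscale hT]
    rw [norm_mul, Complex.norm_real]
    -- Near field: after division by `4Lγ_j` the point `x - y` lies in the cube `|z j| ≤ 3/4`. Far
    -- field: only boundedness of `ρ` and of its Fourier series is used.
    by_cases hy : ‖y‖ ≤ innerRadius L γ
    · have hsum : HasSum (fun r => c r * mExp r z) (rescaledDensity L γ ρ z) := by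
        refine hasSum_of_mem_enlarged_cube hφ h0 hc.of_norm fun j => ?_
        have h1 : |y j| ≤ 2 * L * γ j := by
          have := (EuclideanSpace.norm_eq y ▸ PiLp.norm_apply_le y j : ‖y j‖ ≤ ‖y‖)
          exact (this.trans hy).trans (innerRadius_le L γ j)
        have h2 : |x j| ≤ L * γ j := abs_le.2 (hx j)
        have h3 : |(x - y) j| ≤ |x j| + |y j| := abs_sub _ _
        rw [hz, unscale, abs_div, abs_of_pos (hT j), div_le_iff₀ (hT j)]
        change |(x - y) j| ≤ 3 / 4 * (4 * L * γ j)
        linarith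
      have hfar : farResidual (innerRadius L γ) u v ‖y‖ = 0 :=
        Set.indicator_of_notMem (by simpa using hy) _
      rw [hfar, mul_zero, add_zero, hρz, ← hsum.tsum_eq, mul_comm, norm_sub_rev]
      gcongr
      exact hinterp z
    · have hfar : farResidual (innerRadius L γ) u v ‖y‖ = ‖u ‖y‖ - v ‖y‖‖ :=
        Set.indicator_of_mem (by simpa using hy) _
      rw [hfar, ← add_mul, mul_comm]
      gcongr
      have h1 : ‖∑' r, c r * mExp r z‖ ≤ ∑' r, ‖c r‖ :=
        tsum_of_norm_bounded hc.hasSum fun r => by simp [norm_mExp]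
      have h2 := hinterp z
      have h3 : ‖((ρ (x - y) : ℝ) : ℂ)‖ ≤ S := by
        rw [Complex.norm_real]; exact hS _
      have h4 : ((ρ (x - y) : ℝ) : ℂ) - interpolant L γ ρ N z = ((ρ (x - y) : ℝ) : ℂ) -
          ∑' r, c r * mExp r z - (interpolant L γ ρ N z - ∑' r, c r * mExp r z) := by ring
      rw [h4]
      refine (norm_sub_le _ _).trans ?_
      have := norm_sub_le ((ρ (x - y) : ℝ) : ℂ) (∑' r, c r * mExp r z)
      linarith
  have hbound : Integrable fun y : EuclideanSpace ℝ (Fin d) => 2 * τ * ‖u ‖y‖ - v ‖y‖‖ +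
      (S + ∑' r, ‖c r‖) * farResidual (innerRadius L γ) u v ‖y‖ :=
    (hW.norm.const_mul _).add (hF.const_mul _)
  refine (norm_integral_le_of_norm_le hbound (ae_of_all _ hpt)).trans ?_
  rw [integral_add (hW.norm.const_mul _) (hF.const_mul _), integral_const_mul, integral_const_mul]
  have hfar := integral_farResidual_le hd (innerRadius_nonneg hL hγ) h
  rw [mul_assoc (S + _) _ εtol, mul_right_comm 2 _ τ]
  gcongr

end Error

/-! ### Error of the smooth part -/

section Error

variable {d : ℕ} {L : ℝ} {γ : Fin d → ℝ} {ρ : EuclideanSpace ℝ (Fin d) → ℝ}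

/-- Decay of the Fourier coefficients of the rescaled density. -/
theorem exists_coeff_rescaledDensity_decay (hL : 0 < L) (hγ : ∀ j, 0 < γ j) (hρ : ContDiff ℝ ∞ ρ)
    (hsupp : tsupport ρ ⊆ box L γ) (n : ℕ) :
    ∃ B : ℝ, 0 ≤ B ∧ ∀ r, ‖coeff (rescaledDensity L γ ρ) r‖ ≤ B * ((1 + ‖r‖) ^ n)⁻¹ := by
  -- There is no parameter here, so a dummy one ranges over a single point.
  obtain ⟨B, hB, H⟩ := exists_coeff_decay (X := ℝ) (isCompact_singleton (x := (0 : ℝ)))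
    (G := fun q : ℝ × (Fin d → ℝ) => rescaledDensity L γ ρ q.2)
    (Complex.ofRealCLM.contDiff.comp
      (hρ.comp ((scale fun j => 4 * L * γ j).contDiff.comp contDiff_snd)))
    (fun _ t ht => rescaledDensity_eq_zero hL hγ hρ.continuous hsupp <| by
      by_contra! h
      refine ht.not_ge ((pi_norm_le_iff_of_nonneg (by norm_num)).2 fun j => ?_)
      exact (h j).le.trans (by norm_num)) n
  exact ⟨B, hB, H 0 rfl⟩

/-- Spectral accuracy of the rectangle rule for the convolution with the smooth part of the
kernel, uniformly over the box. -/
theorem exists_smooth_part_error (hL : 0 < L) (hγ : ∀ j, 0 < γ j) (hρ : ContDiff ℝ ∞ ρ)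
    (hsupp : tsupport ρ ⊆ box L γ) {v : ℝ → ℝ}
    (hv : ContDiff ℝ ∞ fun x : EuclideanSpace ℝ (Fin d) => v ‖x‖) (m : ℕ) :
    ∃ C : ℝ, ∀ N : ℕ, 0 < N → Even N → ∀ x ∈ box L γ,
      ‖(∫ y, ((v ‖x - y‖ * ρ y : ℝ) : ℂ)) - ∑ n ∈ indexSet d (N / 2),
        (((∏ j, meshSize L γ N j) * v ‖x - gridPoint L γ N n‖ : ℝ) : ℂ) *
          ((ρ (gridPoint L γ N n) : ℝ) : ℂ)‖ ≤ C * ((N : ℝ) ^ m)⁻¹ := by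
  set T : Fin d → ℝ := fun j => 2 * L * γ j with hTdef
  have hT : ∀ j, 0 < T j := fun j => by have := hγ j; positivity
  set P : ℝ := ∏ j, T j with hP
  have hP0 : 0 < P := Finset.prod_pos fun j _ => hT j
  obtain ⟨g, hg⟩ : ∃ g : EuclideanSpace ℝ (Fin d) × EuclideanSpace ℝ (Fin d) → ℂ,
      g = fun q => ((v ‖q.1 - q.2‖ * ρ q.2 : ℝ) : ℂ) := ⟨_, rfl⟩
  obtain ⟨G, hG⟩ : ∃ G : EuclideanSpace ℝ (Fin d) × (Fin d → ℝ) → ℂ,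
      G = fun q => g (q.1, scale T q.2) := ⟨_, rfl⟩
  have hgsm : ContDiff ℝ ∞ g := by
    have h1 : ContDiff ℝ ∞ fun q : EuclideanSpace ℝ (Fin d) × EuclideanSpace ℝ (Fin d) =>
        v ‖q.1 - q.2‖ :=
      ContDiff.comp (g := fun x : EuclideanSpace ℝ (Fin d) => v ‖x‖)
        (f := fun q : EuclideanSpace ℝ (Fin d) × EuclideanSpace ℝ (Fin d) => q.1 - q.2)
        hv (contDiff_fst.sub contDiff_snd)
    have h2 : ContDiff ℝ ∞ fun q : EuclideanSpace ℝ (Fin d) × EuclideanSpace ℝ (Fin d) =>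
        ρ q.2 := ContDiff.comp (g := ρ) hρ contDiff_snd
    rw [hg]
    exact ContDiff.comp (g := fun a : ℝ => (a : ℂ)) Complex.ofRealCLM.contDiff (h1.mul h2)
  have hGsm : ContDiff ℝ ∞ G := by
    rw [hG]
    exact ContDiff.comp (f := fun q : EuclideanSpace ℝ (Fin d) × (Fin d → ℝ) => (q.1, scale T q.2)) hgsm
      (contDiff_fst.prodMk (ContDiff.comp (g := scale T) (scale T).contDiff contDiff_snd))
  have h0 : ∀ x t, (∃ j, 1 / 2 ≤ |t j|) → G (x, t) = 0 := by
    rintro x t ⟨j, hj⟩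
    have hz : L * γ j ≤ |scale T t j| := by
      rw [scale_apply, abs_mul, abs_of_pos (hT j)]
      have := hγ j
      have : 0 < L * γ j := by positivity
      change L * γ j ≤ 2 * L * γ j * |t j|
      nlinarith
    simp [hG, hg, eq_zero_of_le_abs hρ.continuous hsupp hz]
  have h0' : ∀ x t, 1 / 2 < ‖t‖ → G (x, t) = 0 := by
    refine fun x t ht => h0 x t ?_
    by_contra! h
    exact ht.not_ge ((pi_norm_le_iff_of_nonneg (by norm_num)).2 fun j => (h j).le)
  obtain ⟨B, hB, hdecay⟩ := exists_coeff_decay (isCompact_box L γ) hGsm h0' (m + (d + 1))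
  set S := ∑' r : Fin d → ℤ, ((1 + ‖r‖) ^ (d + 1))⁻¹ with hS
  -- `P` is the volume of the box, and `2 ^ m` comes from `M = N / 2`.
  refine ⟨P * (B * S * 2 ^ m), fun N hN heven x hx => ?_⟩
  obtain ⟨M, rfl⟩ := even_iff_two_dvd.1 heven
  have hM : 0 < M := by omega
  rw [Nat.mul_div_cancel_left M two_pos]
  have hc := hdecay x hx
  have hcs : Summable fun r => ‖coeff (fun t => G (x, t)) r‖ := by
    refine summable_of_decay (B := B) fun r => (hc r).trans ?_
    gcongr B * ?_⁻¹
    exact pow_le_pow_right₀ (by linarith [norm_nonneg r]) (by omega)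
  have hcont : Continuous fun t => G (x, t) := hGsm.continuous.comp (Continuous.prodMk_right x)
  have hq := norm_quadrature_sub_le M hM hcs (f := fun t => G (x, t)) fun n hn =>
    hasSum_coeff_mul_mExp hcont (h0 x) hcs.of_norm fun j => by
      have hM' : (0 : ℝ) < M := by exact_mod_cast hM
      have hnj : |(n j : ℝ)| ≤ M := by
        have := mem_indexSet.1 hn j
        exact_mod_cast abs_le.2 ⟨this.1, this.2.le⟩
      rw [unitGrid, abs_div, abs_of_pos (by positivity : (0 : ℝ) < 2 * M),
        div_le_iff₀ (by positivity)]
      linarith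
  have hint : ∫ y, ((v ‖x - y‖ * ρ y : ℝ) : ℂ) = (P : ℂ) * coeff (fun t => G (x, t)) 0 := by
    have hgc : Continuous fun y => g (x, y) := hgsm.continuous.comp (Continuous.prodMk_right x)
    rw [show (∫ y, ((v ‖x - y‖ * ρ y : ℝ) : ℂ)) = ∫ y, g (x, y) by rw [hg],
      integral_eq_prod_mul_integral_scale hT hgc, coeff]
    simp [mExp_zero, hG, hP]
  have hmesh : ∏ j, meshSize L γ (2 * M) j = P / (2 * M) ^ d := by
    simp [meshSize, hP, hTdef, Finset.prod_div_distrib]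
  have hsum : ∑ n ∈ indexSet d M,
        (((∏ j, meshSize L γ (2 * M) j) * v ‖x - gridPoint L γ (2 * M) n‖ : ℝ) : ℂ) *
          ((ρ (gridPoint L γ (2 * M) n) : ℝ) : ℂ) =
      (P : ℂ) * (1 / (2 * (M : ℂ)) ^ d * ∑ n ∈ indexSet d M, G (x, unitGrid M n)) := by
    rw [hmesh, Finset.mul_sum, Finset.mul_sum]
    refine Finset.sum_congr rfl fun n _ => ?_
    simp only [hG, hg, hTdef, scale_unitGrid]
    push_cast
    ring
  rw [hint, hsum, ← mul_sub, norm_mul, Complex.norm_real, Real.norm_of_nonneg hP0.le,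
    norm_sub_rev, mul_assoc P]
  refine mul_le_mul_of_nonneg_left (hq.trans ?_) hP0.le
  refine (tail_le_of_decay hB hc hM).trans (le_of_eq ?_)
  have hM' : (M : ℝ) ≠ 0 := by exact_mod_cast hM.ne'
  push_cast
  rw [mul_pow, ← hS]
  clear_value S
  field_simp

end Error

end FSA

theorem mainTheorem1 (d : ℕ) (hd : 0 < d) (L : ℝ) (hL : 0 < L)
    (γ : Fin d → ℝ) (hγ : ∀ j, 0 < γ j)
    (ρ : EuclideanSpace ℝ (Fin d) → ℝ) (hρ : ContDiff ℝ ∞ ρ)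
    (hρ_supp : tsupport ρ ⊆ FSA.box L γ) :
    ∃ C₁ : ℝ, ∀ (u v : ℝ → ℝ) (εtol : ℝ),
      MeasureTheory.LocallyIntegrable (fun x : EuclideanSpace ℝ (Fin d) => u ‖x‖) →
      FSA.IsFarFieldApprox d (FSA.innerRadius L γ) εtol u v →
      -- the potential and the Fourier transform of the residual kernel are well defined
      (∀ x : EuclideanSpace ℝ (Fin d), MeasureTheory.Integrable (fun y => u ‖x - y‖ * ρ y)) ∧
      MeasureTheory.Integrable (fun y : EuclideanSpace ℝ (Fin d) => u ‖y‖ - v ‖y‖) ∧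
      -- the error estimate, pointwise on the box and in the `L^∞` norm over the box
      ∀ m : ℕ, 0 < m → ∃ C₂ : ℝ, ∀ N : ℕ, 0 < N → Even N →
        (∀ x ∈ FSA.box L γ,
          ‖((FSA.potential u ρ x : ℝ) : ℂ) - FSA.approxPotential L γ u v ρ N x‖
            ≤ C₂ * (N : ℝ) ^ (-(m : ℤ)) + C₁ * εtol) ∧
        MeasureTheory.eLpNorm
            (fun x => ((FSA.potential u ρ x : ℝ) : ℂ) - FSA.approxPotential L γ u v ρ N x)
            ⊤ (MeasureTheory.volume.restrict (FSA.box L γ))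
          ≤ ENNReal.ofReal (C₂ * (N : ℝ) ^ (-(m : ℤ)) + C₁ * εtol) := by
  open MeasureTheory FSA in
  have hcpt := hasCompactSupport_of_box hρ_supp
  obtain ⟨S, hS⟩ := hρ.continuous.bounded_above_of_compact_support hcpt
  -- Exponent `d + 1` is just enough for summability; fixing it before `m`, `u` and `v` keeps `C₁`
  -- independent of them.
  obtain ⟨B₀, -, hB₀⟩ := exists_coeff_rescaledDensity_decay hL hγ hρ hρ_supp (d + 1)
  have hc := summable_of_decay hB₀
  refine ⟨(S + ∑' r, ‖coeff (rescaledDensity L γ ρ) r‖) *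
    (d * volume.real (Metric.ball (0 : EuclideanSpace ℝ (Fin d)) 1)), fun u v εtol hu h => ?_⟩
  have hW := integrable_residual hd hu h
  refine ⟨integrable_translate_mul hu hρ.continuous hcpt, hW, fun m _ => ?_⟩
  obtain ⟨A, hA⟩ := exists_smooth_part_error hL hγ hρ hρ_supp h.smooth m
  obtain ⟨B, hB, hdecay⟩ := exists_coeff_rescaledDensity_decay hL hγ hρ hρ_supp (m + (d + 1))
  refine ⟨A + 2 * (∫ y : EuclideanSpace ℝ (Fin d), ‖u ‖y‖ - v ‖y‖‖) *
    (B * ∑' r : Fin d → ℤ, ((1 + ‖r‖) ^ (d + 1))⁻¹), fun N hN heven => ?_⟩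
  rw [zpow_neg, zpow_natCast]
  have hpt : ∀ x ∈ box L γ, ‖((potential u ρ x : ℝ) : ℂ) - approxPotential L γ u v ρ N x‖ ≤
      (A + 2 * (∫ y : EuclideanSpace ℝ (Fin d), ‖u ‖y‖ - v ‖y‖‖) *
        (B * ∑' r : Fin d → ℤ, ((1 + ‖r‖) ^ (d + 1))⁻¹)) * ((N : ℝ) ^ m)⁻¹ +
      (S + ∑' r, ‖coeff (rescaledDensity L γ ρ) r‖) *
        (d * volume.real (Metric.ball (0 : EuclideanSpace ℝ (Fin d)) 1)) * εtol := by
    intro x hx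
    have hv : LocallyIntegrable fun y : EuclideanSpace ℝ (Fin d) => v ‖y‖ :=
      h.smooth.continuous.locallyIntegrable
    have hv_int := integrable_translate_mul hv hρ.continuous hcpt x
    have hW_bdd : Integrable fun y : EuclideanSpace ℝ (Fin d) =>
        ((u ‖y‖ - v ‖y‖ : ℝ) : ℂ) * ((ρ (x - y) : ℝ) : ℂ) :=
      integrable_residual_mul_of_bounded hW (by have := hρ.continuous; fun_prop)
        fun y => by rw [Complex.norm_real]; exact hS _
    have hsplit : ((potential u ρ x : ℝ) : ℂ) = (∫ y, ((v ‖x - y‖ * ρ y : ℝ) : ℂ)) +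
        ∫ y : EuclideanSpace ℝ (Fin d), ((u ‖y‖ - v ‖y‖ : ℝ) : ℂ) * ((ρ (x - y) : ℝ) : ℂ) := by
      -- The substitution `y ↦ x - y` puts the residual kernel at `y`, where its integrability and
      -- tail bound are known.
      rw [← integral_sub_left_eq_self (fun y : EuclideanSpace ℝ (Fin d) =>
        ((u ‖y‖ - v ‖y‖ : ℝ) : ℂ) * ((ρ (x - y) : ℝ) : ℂ)) volume x, potential,
        ← integral_complex_ofReal]
      refine Eq.trans ?_ (integral_add hv_int.ofReal (hW_bdd.comp_sub_left x))
      refine integral_congr_ae (ae_of_all _ fun y => ?_)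
      simp only [sub_sub_cancel]
      push_cast
      ring
    have happrox : approxPotential L γ u v ρ N x = (∑ n ∈ indexSet d (N / 2),
        (((∏ j, meshSize L γ N j) * v ‖x - gridPoint L γ N n‖ : ℝ) : ℂ) *
          ((ρ (gridPoint L γ N n) : ℝ) : ℂ)) +
        ∫ y : EuclideanSpace ℝ (Fin d), ((u ‖y‖ - v ‖y‖ : ℝ) : ℂ) *
          interpolant L γ ρ N (unscale (fun j => 4 * L * γ j) (x - y)) := by
      rw [← sum_fourier_part_eq_integral hL hγ hρ.continuous hρ_supp hW hN heven x,
        ← Finset.sum_add_distrib, approxPotential]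
      exact Finset.sum_congr rfl fun n _ => by rw [tensor, add_mul]
    have hI_bdd : Integrable fun y : EuclideanSpace ℝ (Fin d) => ((u ‖y‖ - v ‖y‖ : ℝ) : ℂ) *
        interpolant L γ ρ N (unscale (fun j => 4 * L * γ j) (x - y)) := by
      obtain ⟨C, hC⟩ := exists_norm_interpolant_le (L := L) (γ := γ) (ρ := ρ) N
      exact integrable_residual_mul_of_bounded hW ((continuous_interpolant N).comp
        ((continuous_unscale _).comp (continuous_const.sub continuous_id))) fun y => hC _
    have hfour := norm_fourier_part_sub_le hd hL hγ hρ.continuous hρ_supp hc hS hu h hN hx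
    simp only [mul_sub] at hfour
    rw [integral_sub hW_bdd hI_bdd] at hfour
    rw [hsplit, happrox, add_sub_add_comm]
    refine (norm_add_le _ _).trans ((add_le_add (hA N hN heven x hx) hfour).trans ?_)
    have htail := mul_le_mul_of_nonneg_left (tail_le_of_decay hB hdecay hN)
      (by positivity : 0 ≤ 2 * ∫ y : EuclideanSpace ℝ (Fin d), ‖u ‖y‖ - v ‖y‖‖)
    linarith
  refine ⟨hpt, ?_⟩
  rw [eLpNorm_exponent_top]
  exact eLpNormEssSup_le_of_ae_bound
    (ae_restrict_of_forall_mem (isCompact_box L γ).measurableSet hpt)
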